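/- Let $n\ge 1$ and identify the Heisenberg group $\mathbb H^n$ with $\mathbb R^{2n+1}$ through exponential coordinates, with left-invariant horizontal fields $X_j=\partial_{x_j}-\tfrac{x_{n+j}}2\partial_{x_{2n+1}}$, $X_{n+j}=\partial_{x_{n+j}}+\tfrac{x_j}2\partial_{x_{2n+1}}$ ($1\le j\le n$). Let $\langle\cdot,\cdot\rangle_H$, $|\cdot|_H$ be the inner product and norm on horizontal vectors that make $X_1,\dots,X_{2n}$ orthonormal, and $\nabla_H\varphi=\sum_{i=1}^{2n}(X_i\varphi)X_i$. Let $\Omega\subset\mathbb H^n$ be a bounded domain with $C^{1,1}$ boundary (in the Euclidean sense), $1<p<\infty$, $q=\frac p{p-1}$, and let $\mu,\nu$ be Borel probability measures on $\overline\Omega$. *Traffic plans.* A curve $\sigma:[0,1]\to\overline\Omega$ is horizontal if it is absolutely continuous and $\dot\sigma(t)\in\mathrm{span}\{X_1(\sigma(t)),\dots,X_{2n}(\sigma(t))\}$ for a.e. $t$. Let $\mathcal Q_H(\mu,\nu)$ be the set of Borel probability measures $Q$ on $C([0,1],\overline\Omega)$ (with uniform convergence) that are concentrated on horizontal curves, satisfy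 $\int\ell(\sigma)\,dQ(\sigma)<\infty$, where $\ell$ is the length induced by the sub-Riemannian distance, and have the marginals $(e_0)_\#Q=\mu$, $(e_1)_\#Q=\nu$, where $e_t(\sigma)=\sigma(t)$. For $Q\in\mathcal Q_H(\mu,\nu)$ define the measure $i_Q$ and the horizontal vector measure $\mathbf w_Q$ on $\overline\Omega$ by $$\int\varphi\,di_Q=\int\!\!\int_0^1\varphi(\sigma(t))|\dot\sigma(t)|_H\,dt\,dQ(\sigma),\qquad \int\phi\cdot d\mathbf w_Q=\int\!\!\int_0^1\langle\phi(\sigma(t)),\dot\sigma(t)\rangle_H\,dt\,dQ(\sigma)$$ for all continuous functions $\varphi$ and all continuous horizontal vector fields $\phi$ on $\overline\Omega$. Let $\mathcal Q_H^p(\mu,\nu)$ be the set of $Q\in\mathcal Q_H(\mu,\nu)$ such that $i_Q$ is (the measure with density) a function in $L^p(\Omega)$, again denoted $i_Q$. *Sobolev space and divergence.* $HW^{1,q}(\Omega)$ is the space of $u\in L^q(\Omega)$ whose distributional horizontal gradient is in $L^q$, with norm $\|u\|_{L^q}+\|\nabla_Hu\|_{L^q}$, and $(HW^{1,q})'_\diamond(\Omega)=\{f\in(HW^{1,q}(\Omega))':\langle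 f,1\rangle=0\}$. For a horizontal field $\mathbf w\in L^p(\Omega,H\Omega)$, $\operatorname{div}_H\mathbf w\in(HW^{1,q}(\Omega))'$ is the functional $u\mapsto-\int_\Omega\langle\mathbf w,\nabla_Hu\rangle_H\,dx$. A functional $f\in(HW^{1,q}(\Omega))'$ is identified with the measure $\mu-\nu$ if $\langle f,\varphi|_\Omega\rangle=\int\varphi\,d(\mu-\nu)$ for all $\varphi\in C^\infty(\mathbb H^n)$; the statements $\mu-\nu\in(HW^{1,q})'_\diamond(\Omega)$ and $\operatorname{div}_H\mathbf w=\mu-\nu$ are understood in this sense. *The two problems.* Let $G:\overline\Omega\times[0,\infty)\to\mathbb R$ be such that $G(\cdot,i)$ is Lebesgue measurable for each $i$, $G(x,0)=0$, $G(x,\cdot)$ is convex and non-decreasing, and $\frac ap i^p-h_0(x)\le G(x,i)\le\frac bp i^p+h_1(x)$ for all $(x,i)\in\overline\Omega\times[0,\infty)$, with some $a,b>0$ and non-negative $h_0,h_1\in L^p(\Omega)$. Put $$(\mathcal B)=\inf\Big\{\int_\Omega G(x,|\mathbf w(x)|_H)\,dx:\ \mathbf w\in L^p(\Omega,H\Omega),\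 \operatorname{div}_H\mathbf w=\mu-\nu\Big\},\qquad(\mathcal W)=\inf_{Q\in\mathcal Q^p_H(\mu,\nu)}\int_\Omega G(x,i_Q(x))\,dx .$$ **Proposition.** Suppose that $\mathcal Q_H^p(\mu,\nu)\neq\emptyset$. Then $\mu-\nu\in(HW^{1,q})'_\diamond(\Omega)$. More precisely, for every $Q\in\mathcal Q_H^p(\mu,\nu)$ the vector measure $\mathbf w_Q$ is (the measure with density) a field in $L^p(\Omega,H\Omega)$ that is admissible for $(\mathcal B)$, that is, $\operatorname{div}_H\mathbf w_Q=\mu-\nu$, and $|\mathbf w_Q|_H\le i_Q$ a.e. in $\Omega$. Consequently, for every $G$ as above, $(\mathcal B)\le(\mathcal W)$. -/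

import Mathlib

open MeasureTheory Set Filter Topology
open scoped ENNReal NNReal ContDiff InnerProductSpace

noncomputable section

namespace Heis

/-! ### The Heisenberg group in exponential coordinates and its horizontal frame -/

/-- Exponential coordinates `ℝ^{2n+1}` on the Heisenberg group, with the Euclidean norm. The
coordinate `x_j` (`1 ≤ j ≤ n`) is `x (.inl (.inl j))`, the coordinate `x_{n+j}` is
`x (.inl (.inr j))` and the vertical coordinate `x_{2n+1}` is `x (.inr ())`. -/
abbrev Pt (n : ℕ) : Type := EuclideanSpace ℝ ((Fin n ⊕ Fin n) ⊕ Unit)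

/-- Coordinates `(v_1, …, v_{2n})` of a horizontal vector `∑ v_i X_i(x)` with respect to the
horizontal frame. As the frame is orthonormal for the sub-Riemannian metric, the Euclidean norm and
inner product of this space are `|·|_H` and `⟨·,·⟩_H`. Horizontal vector fields are identified with
functions with values in `Hor n`. -/
abbrev Hor (n : ℕ) : Type := EuclideanSpace ℝ (Fin n ⊕ Fin n)

/-- The coefficient of `∂_{x_{2n+1}}` in `X_i`: it is `-x_{n+j}/2` for `X_j` and `x_j/2` for
`X_{n+j}`. -/
def vertCoef {n : ℕ} (i : Fin n ⊕ Fin n) (x : Pt n) : ℝ :=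
  match i with
  | .inl j => -(x (.inl (.inr j)) / 2)
  | .inr j => x (.inl (.inl j)) / 2

/-- The left-invariant horizontal vector fields `X_1, …, X_{2n}`. -/
def X {n : ℕ} (i : Fin n ⊕ Fin n) (x : Pt n) : Pt n :=
  EuclideanSpace.single (.inl i) 1 + vertCoef i x • EuclideanSpace.single (.inr ()) 1

/-- The horizontal fibre at `x`. -/
def horFibre {n : ℕ} (x : Pt n) : Submodule ℝ (Pt n) :=
  Submodule.span ℝ (range fun i => X i x)

/-- The coordinates of a horizontal vector in the frame `X_1(x), …, X_{2n}(x)`: these are its first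
`2n` Euclidean coordinates, whatever `x` is (see `horFibre_eq_sum`). -/
def horCoord {n : ℕ} (v : Pt n) : Hor n := WithLp.toLp 2 fun i => v (.inl i)

lemma horCoord_sum {n : ℕ} (x : Pt n) (a : Fin n ⊕ Fin n → ℝ) :
    horCoord (∑ i, a i • X i x) = WithLp.toLp 2 a := by
  ext i
  rcases i with i | i <;> simp [horCoord, X, Pi.single_apply]

lemma horFibre_eq_sum {n : ℕ} {x v : Pt n} (hv : v ∈ horFibre x) :
    v = ∑ i, horCoord v i • X i x := by
  obtain ⟨a, rfl⟩ := (Submodule.mem_span_range_iff_exists_fun ℝ).1 hv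
  rw [horCoord_sum]

/-- The horizontal gradient `(X_1 φ, …, X_{2n} φ)` of a differentiable function. -/
def gradH {n : ℕ} (φ : Pt n → ℝ) (x : Pt n) : Hor n :=
  WithLp.toLp 2 fun i => fderiv ℝ φ x (X i x)

/-! ### Horizontal curves, sub-Riemannian distance and length -/

/-- An absolutely continuous curve on `[0,1]` whose velocity is horizontal almost everywhere. -/
def IsHorizontal {n : ℕ} (γ : ℝ → Pt n) : Prop :=
  AbsolutelyContinuousOnInterval γ 0 1 ∧
    ∀ᵐ t ∂volume.restrict (Icc (0 : ℝ) 1), deriv γ t ∈ horFibre (γ t)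

/-- The sub-Riemannian length `∫_0^1 |γ'(t)|_H dt` of a horizontal curve. -/
def lengthSR {n : ℕ} (γ : ℝ → Pt n) : ℝ≥0∞ :=
  ∫⁻ t in Icc (0 : ℝ) 1, ‖horCoord (deriv γ t)‖ₑ

/-- The sub-Riemannian distance. -/
def distSR {n : ℕ} (x y : Pt n) : ℝ≥0∞ :=
  ⨅ (γ : ℝ → Pt n) (_ : IsHorizontal γ ∧ γ 0 = x ∧ γ 1 = y), lengthSR γ

/-- The length of a curve on `[0,1]` induced by the sub-Riemannian distance: the supremum of
`∑ d_SR(γ(t_{i-1}), γ(t_i))` over the partitions `0 = t_0 < t_1 < ⋯ < t_k = 1`. -/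
def length {n : ℕ} (γ : ℝ → Pt n) : ℝ≥0∞ :=
  ⨆ (k : ℕ) (t : ℕ → ℝ) (_ : StrictMonoOn t (Iic k) ∧ t 0 = 0 ∧ t k = 1),
    ∑ i ∈ Finset.range k, distSR (γ (t i)) (γ (t (i + 1)))

/-! ### Domains -/

/-- A bounded domain (non-empty, open, connected) with `C^{1,1}` boundary in the Euclidean sense:
near each boundary point the domain lies above the graph, in some direction `e`, of a
`C^1` function with Lipschitz derivative. The value of `g` is only used on the hyperplane
orthogonal to `e`. -/
structure Domain (n : ℕ) where
  carrier : Set (Pt n)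
  isOpen : IsOpen carrier
  isConnected : IsConnected carrier
  isBounded : Bornology.IsBounded carrier
  boundary : ∀ x₀ ∈ frontier carrier, ∃ (r : ℝ) (e : Pt n) (g : Pt n → ℝ) (K : ℝ≥0),
    0 < r ∧ ‖e‖ = 1 ∧ ContDiff ℝ 1 g ∧ LipschitzWith K (fderiv ℝ g) ∧
    ∀ x ∈ Metric.ball x₀ r, x ∈ carrier ↔ g (x - ⟪e, x⟫_ℝ • e) < ⟪e, x⟫_ℝ

/-- The closure of the domain, as a type. -/
abbrev Domain.Closure {n : ℕ} (Ω : Domain n) : Type := ↥(closure Ω.carrier)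

/-- Lebesgue measure on `Ω`. -/
def Domain.leb {n : ℕ} (Ω : Domain n) : Measure (Pt n) := volume.restrict Ω.carrier

/-- Lebesgue measure on `Ω`, seen as a measure on the closure of `Ω`. -/
def Domain.lebClosure {n : ℕ} (Ω : Domain n) : Measure Ω.Closure := Ω.leb.comap Subtype.val

instance {n : ℕ} (Ω : Domain n) : IsFiniteMeasure Ω.leb :=
  ⟨by simpa [Domain.leb] using Ω.isBounded.measure_lt_top⟩

lemma Domain.isCompact_closure {n : ℕ} (Ω : Domain n) : IsCompact (closure Ω.carrier) :=
  Ω.isBounded.isCompact_closure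

/-! ### The horizontal Sobolev space and its dual -/

/-- `g` is the horizontal gradient of `u` on `Ω` in the sense of distributions. (The fields `X_i`
are divergence free, so `X_i` is formally skew-adjoint.) -/
def IsWeakGradH {n : ℕ} (Ω : Domain n) (u : Pt n → ℝ) (g : Pt n → Hor n) : Prop :=
  ∀ ψ : Pt n → ℝ, ContDiff ℝ ∞ ψ → HasCompactSupport ψ → tsupport ψ ⊆ Ω.carrier →
    ∀ i, ∫ x, u x * gradH ψ x i ∂Ω.leb = -∫ x, g x i * ψ x ∂Ω.leb

lemma continuous_vertCoef {n : ℕ} (i : Fin n ⊕ Fin n) : Continuous (vertCoef (n := n) i) := by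
  rcases i with j | j <;> unfold vertCoef <;> fun_prop

lemma continuous_X {n : ℕ} (i : Fin n ⊕ Fin n) : Continuous (X (n := n) i) := by
  have := continuous_vertCoef i
  unfold X
  fun_prop

lemma continuous_gradH {n : ℕ} {φ : Pt n → ℝ} (hφ : ContDiff ℝ ∞ φ) :
    Continuous (gradH φ) := by
  have h := hφ.continuous_fderiv (by simp)
  have h2 := fun i => continuous_X (n := n) i
  unfold gradH
  refine (PiLp.continuous_toLp 2 _).comp (continuous_pi fun i => ?_)
  exact h.clm_apply (h2 i)

/-- A continuous function is in every `L^q(Ω)`, the domain being bounded. -/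
lemma memLp_of_continuous {n : ℕ} (Ω : Domain n) {E : Type*} [NormedAddCommGroup E]
    [SecondCountableTopology E] {f : Pt n → E} (hf : Continuous f) (q : ℝ≥0∞) :
    MemLp f q Ω.leb := by
  borelize E
  obtain ⟨C, hC⟩ := Ω.isCompact_closure.exists_bound_of_continuousOn hf.continuousOn
  refine MemLp.of_bound hf.aestronglyMeasurable C ?_
  exact (ae_restrict_mem Ω.isOpen.measurableSet).mono fun x hx => hC x (subset_closure hx)

/-- Integrability of an `L^q(Ω)` function times a continuous one. -/
lemma integrable_mul {n : ℕ} (Ω : Domain n) {q : ℝ≥0∞} (hq : 1 ≤ q) {u v : Pt n → ℝ}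
    (hu : MemLp u q Ω.leb) (hv : Continuous v) : Integrable (fun x => u x * v x) Ω.leb :=
  (hu.integrable hq).mul_of_top_left (memLp_of_continuous Ω hv ∞)

lemma memLp_coord {n : ℕ} (Ω : Domain n) {q : ℝ≥0∞} {g : Pt n → Hor n}
    (hg : MemLp g q Ω.leb) (i : Fin n ⊕ Fin n) : MemLp (fun x => g x i) q Ω.leb :=
  hg.continuousLinearMap_comp (EuclideanSpace.proj i : Hor n →L[ℝ] ℝ)

/-- The horizontal Sobolev space `HW^{1,q}(Ω)`. Its elements are the pairs `(u, ∇_H u)` with `u` and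
its distributional horizontal gradient in `L^q`; the norm is `‖u‖_{L^q} + ‖∇_H u‖_{L^q}`. -/
def HW {n : ℕ} (Ω : Domain n) (q : ℝ≥0∞) [Fact (1 ≤ q)] :
    Submodule ℝ (WithLp 1 (Lp ℝ q Ω.leb × Lp (Hor n) q Ω.leb)) where
  carrier := {u | IsWeakGradH Ω u.fst u.snd}
  zero_mem' := by
    intro ψ _ _ _ i
    have h1 : (fun x => ((0 : Lp ℝ q Ω.leb) : Pt n → ℝ) x * gradH ψ x i) =ᵐ[Ω.leb] 0 := by
      filter_upwards [Lp.coeFn_zero ℝ q Ω.leb] with x hx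
      rw [hx]
      simp
    have h2 : (fun x => ((0 : Lp (Hor n) q Ω.leb) : Pt n → Hor n) x i * ψ x) =ᵐ[Ω.leb] 0 := by
      filter_upwards [Lp.coeFn_zero (Hor n) q Ω.leb] with x hx
      rw [hx]
      simp
    change ∫ x, ((0 : Lp ℝ q Ω.leb) : Pt n → ℝ) x * gradH ψ x i ∂Ω.leb =
      -∫ x, ((0 : Lp (Hor n) q Ω.leb) : Pt n → Hor n) x i * ψ x ∂Ω.leb
    rw [integral_congr_ae h1, integral_congr_ae h2]
    simp
  add_mem' := by
    intro u v hu hv ψ h1 h2 h3 i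
    have hq : 1 ≤ q := Fact.out
    have hc : Continuous fun x => gradH ψ x i :=
      (EuclideanSpace.proj i : Hor n →L[ℝ] ℝ).continuous.comp (continuous_gradH h1)
    have e1 : (fun x => (u + v).fst x * gradH ψ x i) =ᵐ[Ω.leb]
        fun x => u.fst x * gradH ψ x i + v.fst x * gradH ψ x i := by
      filter_upwards [Lp.coeFn_add u.fst v.fst] with x hx
      rw [WithLp.add_fst, hx, Pi.add_apply, add_mul]
    have e2 : (fun x => (u + v).snd x i * ψ x) =ᵐ[Ω.leb]
        fun x => u.snd x i * ψ x + v.snd x i * ψ x := by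
      filter_upwards [Lp.coeFn_add u.snd v.snd] with x hx
      rw [WithLp.add_snd, hx, Pi.add_apply, PiLp.add_apply, add_mul]
    rw [integral_congr_ae e1, integral_congr_ae e2,
      integral_add (integrable_mul Ω hq (Lp.memLp u.fst) hc)
        (integrable_mul Ω hq (Lp.memLp v.fst) hc),
      integral_add (integrable_mul Ω hq (memLp_coord Ω (Lp.memLp u.snd) i) h1.continuous)
        (integrable_mul Ω hq (memLp_coord Ω (Lp.memLp v.snd) i) h1.continuous),
      hu ψ h1 h2 h3 i, hv ψ h1 h2 h3 i]
    ring
  smul_mem' := by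
    intro c u hu ψ h1 h2 h3 i
    have e1 : (fun x => (c • u).fst x * gradH ψ x i) =ᵐ[Ω.leb]
        fun x => c * (u.fst x * gradH ψ x i) := by
      filter_upwards [Lp.coeFn_smul c u.fst] with x hx
      rw [WithLp.smul_fst, hx, Pi.smul_apply, smul_eq_mul, mul_assoc]
    have e2 : (fun x => (c • u).snd x i * ψ x) =ᵐ[Ω.leb]
        fun x => c * (u.snd x i * ψ x) := by
      filter_upwards [Lp.coeFn_smul c u.snd] with x hx
      rw [WithLp.smul_snd, hx, Pi.smul_apply, PiLp.smul_apply, smul_eq_mul, mul_assoc]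
    rw [integral_congr_ae e1, integral_congr_ae e2, integral_const_mul, integral_const_mul,
      hu ψ h1 h2 h3 i]
    ring

lemma contDiff_vertCoef {n : ℕ} (i : Fin n ⊕ Fin n) : ContDiff ℝ ∞ (vertCoef (n := n) i) := by
  rcases i with j | j <;> unfold vertCoef <;> fun_prop

lemma fderiv_vertCoef {n : ℕ} (i : Fin n ⊕ Fin n) (x : Pt n) :
    fderiv ℝ (vertCoef i) x (EuclideanSpace.single (.inr ()) 1) = 0 := by
  have hd : DifferentiableAt ℝ (vertCoef (n := n) i) x :=
    (contDiff_vertCoef i).differentiable (by simp) x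
  rw [← hd.lineDeriv_eq_fderiv, lineDeriv]
  have h : (fun s : ℝ => vertCoef i (x + s • EuclideanSpace.single (.inr ()) (1 : ℝ))) =
      fun _ => vertCoef i x := by
    funext s
    rcases i with j | j <;> simp [vertCoef]
  rw [h, deriv_const]

lemma integral_mul_fderiv_smooth {n : ℕ} {f ψ : Pt n → ℝ} (hf : ContDiff ℝ ∞ f)
    (h1 : ContDiff ℝ ∞ ψ) (h2 : HasCompactSupport ψ) (v : Pt n) :
    Integrable (fun x => f x * fderiv ℝ ψ x v) ∧ Integrable (fun x => fderiv ℝ f x v * ψ x) ∧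
    ∫ x, f x * fderiv ℝ ψ x v = -∫ x, fderiv ℝ f x v * ψ x := by
  have cf : Continuous fun x => fderiv ℝ f x v :=
    (hf.continuous_fderiv (by simp)).clm_apply continuous_const
  have cψ : Continuous fun x => fderiv ℝ ψ x v :=
    (h1.continuous_fderiv (by simp)).clm_apply continuous_const
  have i1 : Integrable fun x => f x * fderiv ℝ ψ x v :=
    (hf.continuous.mul cψ).integrable_of_hasCompactSupport (h2.fderiv_apply ℝ v).mul_left
  have i2 : Integrable fun x => fderiv ℝ f x v * ψ x :=
    (cf.mul h1.continuous).integrable_of_hasCompactSupport h2.mul_left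
  have i3 : Integrable fun x => f x * ψ x :=
    (hf.continuous.mul h1.continuous).integrable_of_hasCompactSupport h2.mul_left
  exact ⟨i1, i2, integral_mul_fderiv_eq_neg_fderiv_mul_of_integrable i2 i1 i3
    (fun x _ => hf.differentiable (by simp) x) (fun x _ => h1.differentiable (by simp) x)⟩

/-- Integration by parts along the fields `X_i`: the horizontal gradient of a smooth function is
its distributional horizontal gradient. -/
lemma isWeakGradH_of_smooth {n : ℕ} (Ω : Domain n) {φ : Pt n → ℝ} (hφ : ContDiff ℝ ∞ φ) :
    IsWeakGradH Ω φ (gradH φ) := by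
  intro ψ h1 h2 h3 i
  have o1 : ∀ x, x ∉ Ω.carrier → φ x * gradH ψ x i = 0 := by
    intro x hx
    have : fderiv ℝ ψ x = 0 := by
      by_contra hne
      exact hx (h3 (support_fderiv_subset ℝ hne))
    simp [gradH, this]
  have o2 : ∀ x, x ∉ Ω.carrier → gradH φ x i * ψ x = 0 := by
    intro x hx
    rw [image_eq_zero_of_notMem_tsupport fun h => hx (h3 h), mul_zero]
  rw [Domain.leb, setIntegral_eq_integral_of_forall_compl_eq_zero o1,
    setIntegral_eq_integral_of_forall_compl_eq_zero o2]
  obtain ⟨a1, a2, a3⟩ := integral_mul_fderiv_smooth hφ h1 h2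
    (EuclideanSpace.single (.inl i) (1 : ℝ))
  obtain ⟨b1, b2, b3⟩ := integral_mul_fderiv_smooth (hφ.mul (contDiff_vertCoef i)) h1 h2
    (EuclideanSpace.single (.inr ()) (1 : ℝ))
  have e1 : (fun x => φ x * gradH ψ x i) = fun x =>
      φ x * fderiv ℝ ψ x (EuclideanSpace.single (.inl i) (1 : ℝ)) +
      φ x * vertCoef i x * fderiv ℝ ψ x (EuclideanSpace.single (.inr ()) (1 : ℝ)) := by
    funext x
    simp only [gradH, X, map_add, map_smul, smul_eq_mul]
    ring
  have e2 : (fun x => gradH φ x i * ψ x) = fun x =>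
      fderiv ℝ φ x (EuclideanSpace.single (.inl i) (1 : ℝ)) * ψ x +
      fderiv ℝ (fun x => φ x * vertCoef i x) x (EuclideanSpace.single (.inr ()) (1 : ℝ)) * ψ x := by
    funext x
    rw [fderiv_fun_mul (hφ.differentiable (by simp) x)
      ((contDiff_vertCoef i).differentiable (by simp) x)]
    simp only [gradH, X, map_add, map_smul, smul_eq_mul, add_apply, smul_apply, fderiv_vertCoef]
    ring
  rw [e1, e2, integral_add a1 b1, integral_add a2 b2, a3, b3]
  ring

/-- The element of `HW^{1,q}(Ω)` given by the restriction to `Ω` of a smooth function on the whole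
space. -/
def HW.ofSmooth {n : ℕ} (Ω : Domain n) (q : ℝ≥0∞) [Fact (1 ≤ q)] (φ : Pt n → ℝ)
    (hφ : ContDiff ℝ ∞ φ) : HW Ω q :=
  ⟨WithLp.toLp 1 ((memLp_of_continuous Ω hφ.continuous q).toLp φ,
    (memLp_of_continuous Ω (continuous_gradH hφ) q).toLp (gradH φ)), by
    intro ψ h1 h2 h3 i
    have e1 : (fun x => ((memLp_of_continuous Ω hφ.continuous q).toLp φ) x * gradH ψ x i)
        =ᵐ[Ω.leb] fun x => φ x * gradH ψ x i := by
      filter_upwards [(memLp_of_continuous Ω hφ.continuous q).coeFn_toLp] with x hx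
      rw [hx]
    have e2 : (fun x => ((memLp_of_continuous Ω (continuous_gradH hφ) q).toLp (gradH φ)) x i * ψ x)
        =ᵐ[Ω.leb] fun x => gradH φ x i * ψ x := by
      filter_upwards [(memLp_of_continuous Ω (continuous_gradH hφ) q).coeFn_toLp] with x hx
      rw [hx]
    exact (integral_congr_ae e1).trans
      ((isWeakGradH_of_smooth Ω hφ ψ h1 h2 h3 i).trans (congrArg Neg.neg (integral_congr_ae e2).symm))⟩

/-- The closed subspace of `(HW^{1,q}(Ω))'` of the functionals `f` with `⟨f, 1⟩ = 0`. -/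
def dualDiamond {n : ℕ} (Ω : Domain n) (q : ℝ≥0∞) [Fact (1 ≤ q)] :
    Submodule ℝ (StrongDual ℝ (HW Ω q)) where
  carrier := {f | f (HW.ofSmooth Ω q (fun _ => 1) contDiff_const) = 0}
  zero_mem' := by simp
  add_mem' := by
    intro f g hf hg
    simp only [mem_ofPred_eq] at hf hg ⊢
    simp [hf, hg]
  smul_mem' := by
    intro c f hf
    simp only [mem_ofPred_eq] at hf ⊢
    simp [hf]

/-- The functional `f` on `HW^{1,q}(Ω)` is the signed measure `μ - ν` (on the closure of `Ω`):
`⟨f, φ⟩ = ∫ φ d(μ - ν)` for all smooth `φ` on the whole space. -/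
def EqDiff {n : ℕ} {Ω : Domain n} {q : ℝ≥0∞} [Fact (1 ≤ q)] (f : StrongDual ℝ (HW Ω q))
    (μ ν : Measure Ω.Closure) : Prop :=
  ∀ (φ : Pt n → ℝ) (hφ : ContDiff ℝ ∞ φ),
    f (HW.ofSmooth Ω q φ hφ) = ∫ x : Ω.Closure, φ x ∂μ - ∫ x : Ω.Closure, φ x ∂ν

/-- The horizontal divergence `div_H w ∈ (HW^{1,q}(Ω))'` of `w ∈ L^p(Ω, HΩ)`:
`⟨div_H w, u⟩ = -∫_Ω ⟨w, ∇_H u⟩_H dx` (see `divH_apply`). -/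
def divH {n : ℕ} {Ω : Domain n} {p : ℝ≥0∞} (q : ℝ≥0∞) [Fact (1 ≤ p)] [Fact (1 ≤ q)]
    [ENNReal.HolderConjugate p q] (w : Lp (Hor n) p Ω.leb) : StrongDual ℝ (HW Ω q) :=
  -(((innerSL ℝ).lpPairing Ω.leb p q w).comp
    ((WithLp.sndL 1 ℝ (Lp ℝ q Ω.leb) (Lp (Hor n) q Ω.leb)).comp (HW Ω q).subtypeL))

lemma divH_apply {n : ℕ} {Ω : Domain n} {p q : ℝ≥0∞} [Fact (1 ≤ p)] [Fact (1 ≤ q)]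
    [ENNReal.HolderConjugate p q] (w : Lp (Hor n) p Ω.leb) (u : HW Ω q) :
    divH q w u = -∫ x, ⟪w x, u.1.snd x⟫_ℝ ∂Ω.leb := by
  simp only [divH, neg_apply, ContinuousLinearMap.comp_apply]
  rw [ContinuousLinearMap.lpPairing_eq_integral]
  rfl

/-! ### Horizontal traffic plans and traffic intensities -/

/-- The space `C([0,1], closure Ω)` with the topology of uniform convergence. -/
abbrev PathSpace {n : ℕ} (Ω : Domain n) : Type := C(unitInterval, Ω.Closure)

instance {n : ℕ} (Ω : Domain n) : MeasurableSpace (PathSpace Ω) := borel _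

instance {n : ℕ} (Ω : Domain n) : BorelSpace (PathSpace Ω) := ⟨rfl⟩

/-- The position at time `t` of a path, extended by constants outside `[0,1]`. -/
def PathSpace.pos {n : ℕ} {Ω : Domain n} (σ : PathSpace Ω) (t : ℝ) : Ω.Closure :=
  σ (projIcc 0 1 zero_le_one t)

/-- A path seen as a curve in the whole space. -/
def PathSpace.curve {n : ℕ} {Ω : Domain n} (σ : PathSpace Ω) (t : ℝ) : Pt n := (σ.pos t : Pt n)

/-- The velocity of a path, in coordinates with respect to the horizontal frame. -/
def PathSpace.vel {n : ℕ} {Ω : Domain n} (σ : PathSpace Ω) (t : ℝ) : Hor n := horCoord (deriv σ.curve t)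

/-- The set of horizontal traffic plans between `μ` and `ν`. -/
def trafficPlans {n : ℕ} {Ω : Domain n} (μ ν : Measure Ω.Closure) : Set (Measure (PathSpace Ω)) :=
  {Q | IsProbabilityMeasure Q ∧ ∫⁻ σ : PathSpace Ω, length σ.curve ∂Q < ⊤ ∧
    (∀ᵐ σ : PathSpace Ω ∂Q, IsHorizontal σ.curve) ∧
    Q.map (fun σ => σ 0) = μ ∧ Q.map (fun σ => σ 1) = ν}

/-- The horizontal traffic intensity `i_Q`, as a measure on the closure of `Ω`: the image under
`(σ, t) ↦ σ(t)` of the measure with density `|σ'(t)|_H` with respect to `Q ⊗ dt`. It is characterized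
by `∫ φ d i_Q = ∫ ∫_0^1 φ(σ(t)) |σ'(t)|_H dt dQ(σ)` (see `lintegral_trafficIntensity`). -/
def trafficIntensity {n : ℕ} {Ω : Domain n} (Q : Measure (PathSpace Ω)) : Measure Ω.Closure :=
  ((Q.prod (volume.restrict (Icc (0 : ℝ) 1))).withDensity fun z => ‖z.1.vel z.2‖ₑ).map
    fun z => z.1.pos z.2

lemma continuous_pos {n : ℕ} {Ω : Domain n} :
    Continuous fun z : PathSpace Ω × ℝ => z.1.pos z.2 := by
  unfold PathSpace.pos
  have : Continuous fun z : PathSpace Ω × ℝ => projIcc (0 : ℝ) 1 zero_le_one z.2 :=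
    continuous_projIcc.comp continuous_snd
  exact continuous_fst.eval this

lemma measurable_vel {n : ℕ} {Ω : Domain n} :
    Measurable fun z : PathSpace Ω × ℝ => z.1.vel z.2 := by
  have h : Continuous (Function.uncurry fun (σ : PathSpace Ω) (t : ℝ) => σ.curve t) :=
    continuous_subtype_val.comp continuous_pos
  have h2 : Continuous (horCoord (n := n)) := by unfold horCoord; fun_prop
  exact h2.measurable.comp (measurable_deriv_with_param h)

lemma lintegral_trafficIntensity {n : ℕ} {Ω : Domain n} (Q : Measure (PathSpace Ω))
    {f : Ω.Closure → ℝ≥0∞} (hf : Measurable f) :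
    ∫⁻ x, f x ∂trafficIntensity Q =
      ∫⁻ σ, (∫⁻ t in Icc (0 : ℝ) 1, f (PathSpace.pos σ t) * ‖PathSpace.vel σ t‖ₑ) ∂Q := by
  have hv : Measurable fun z : PathSpace Ω × ℝ => ‖z.1.vel z.2‖ₑ := measurable_vel.enorm
  have hp : Measurable fun z : PathSpace Ω × ℝ => z.1.pos z.2 := continuous_pos.measurable
  have hfp : Measurable fun z : PathSpace Ω × ℝ => f (z.1.pos z.2) := hf.comp hp
  rw [trafficIntensity, lintegral_map hf hp, lintegral_withDensity_eq_lintegral_mul _ hv hfp,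
    lintegral_prod _ (hv.mul hfp).aemeasurable]
  simp [mul_comm]

/-- The density of `i_Q` with respect to Lebesgue measure on `Ω`. -/
def intensityDensity {n : ℕ} {Ω : Domain n} (Q : Measure (PathSpace Ω)) (x : Pt n) : ℝ :=
  (((trafficIntensity Q).map Subtype.val).rnDeriv Ω.leb x).toReal

/-- The set `Q_H^p(μ, ν)` of the horizontal traffic plans whose traffic intensity is a
function in `L^p(Ω)`. -/
def trafficPlansLp {n : ℕ} {Ω : Domain n} (p : ℝ≥0∞) (μ ν : Measure Ω.Closure) :
    Set (Measure (PathSpace Ω)) :=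
  {Q | Q ∈ trafficPlans μ ν ∧ MemLp (intensityDensity Q) p Ω.leb ∧
    (trafficIntensity Q).map Subtype.val =
      Ω.leb.withDensity fun x => ENNReal.ofReal (intensityDensity Q x)}

/-- The vector horizontal traffic intensity `w_Q`, as a functional on the continuous horizontal
vector fields on the closure of `Ω`:
`∫ φ · dw_Q = ∫ ∫_0^1 ⟨φ(σ(t)), σ'(t)⟩_H dt dQ(σ)`. -/
def vectorTrafficIntensity {n : ℕ} {Ω : Domain n} (Q : Measure (PathSpace Ω))
    (φ : C(Ω.Closure, Hor n)) : ℝ :=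
  ∫ σ, (∫ t in (0 : ℝ)..1, ⟪φ (PathSpace.pos σ t), PathSpace.vel σ t⟫_ℝ) ∂Q

/-- The vector measure on the closure of `Ω` with density `w` with respect to Lebesgue measure on
`Ω`, as a functional on the continuous horizontal vector fields. -/
def densityFunctional {n : ℕ} {Ω : Domain n} {p : ℝ≥0∞} (w : Lp (Hor n) p Ω.leb)
    (φ : C(Ω.Closure, Hor n)) : ℝ :=
  ∫ x : Ω.Closure, ⟪φ x, w (x : Pt n)⟫_ℝ ∂Ω.lebClosure

/-! ### The two minimization problems -/

/-- The conditions on the congestion function `G` on `closure Ω × [0,∞)`: measurable in `x`, zero at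
`i = 0`, convex and non-decreasing in `i`, and of `p`-growth in `i`. In particular `G ≥ 0`. -/
structure IsCongestionFunction {n : ℕ} (Ω : Domain n) (p : ℝ≥0∞) (G : Pt n → ℝ → ℝ) : Prop where
  measurable : ∀ i, 0 ≤ i → AEMeasurable (fun x => G x i) Ω.leb
  zero : ∀ x ∈ closure Ω.carrier, G x 0 = 0
  convex : ∀ x ∈ closure Ω.carrier, ConvexOn ℝ (Ici 0) (G x)
  monotone : ∀ x ∈ closure Ω.carrier, MonotoneOn (G x) (Ici 0)
  growth : ∃ (a b : ℝ) (h₀ h₁ : Pt n → ℝ), 0 < a ∧ 0 < b ∧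
    MemLp h₀ p Ω.leb ∧ MemLp h₁ p Ω.leb ∧
    ∀ x ∈ closure Ω.carrier, 0 ≤ h₀ x ∧ 0 ≤ h₁ x ∧ ∀ i : ℝ, 0 ≤ i →
      a / p.toReal * i ^ p.toReal - h₀ x ≤ G x i ∧
      G x i ≤ b / p.toReal * i ^ p.toReal + h₁ x

/-- The set of the `w ∈ L^p(Ω, HΩ)` with `div_H w = μ - ν`. -/
def beckmannAdmissible {n : ℕ} {Ω : Domain n} (p q : ℝ≥0∞) [Fact (1 ≤ p)] [Fact (1 ≤ q)]
    [ENNReal.HolderConjugate p q] (μ ν : Measure Ω.Closure) : Set (Lp (Hor n) p Ω.leb) :=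
  {w | EqDiff (divH q w) μ ν}

/-- The value of the Beckmann problem: the infimum of `∫_Ω G(x, |w(x)|_H) dx` over the admissible `w`.
The integrand is non-negative for a congestion function `G`. -/
def beckmannValue {n : ℕ} {Ω : Domain n} (p q : ℝ≥0∞) [Fact (1 ≤ p)] [Fact (1 ≤ q)]
    [ENNReal.HolderConjugate p q] (μ ν : Measure Ω.Closure) (G : Pt n → ℝ → ℝ) : ℝ≥0∞ :=
  ⨅ w ∈ beckmannAdmissible p q μ ν, ∫⁻ x, ENNReal.ofReal (G x ‖w x‖) ∂Ω.leb

/-- The value of the congested transport problem: the infimum of `∫_Ω G(x, i_Q(x)) dx` over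
`Q_H^p(μ, ν)`. -/
def congestedValue {n : ℕ} {Ω : Domain n} (p : ℝ≥0∞) (μ ν : Measure Ω.Closure)
    (G : Pt n → ℝ → ℝ) : ℝ≥0∞ :=
  ⨅ Q ∈ trafficPlansLp p μ ν, ∫⁻ x, ENNReal.ofReal (G x (intensityDensity Q x)) ∂Ω.leb

end Heis

end

open MeasureTheory Set Filter Topology
open scoped ENNReal NNReal ContDiff InnerProductSpace

/-! Weight each pair (path, time) by the horizontal speed; the image of this measure under the
position map is `i_Q`. It is finite when `i_Q` is in `L^p`, so the joint law of position and
velocity disintegrates over `i_Q`. Averaging the unit direction of motion over the conditional law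
at `x` gives a vector of norm at most 1 (`norm_meanDirection_le`), and `w_Q` is this mean direction
times `i_Q` (`vectorTrafficIntensity_eq_integral`). Hence `w_Q` inherits an `L^p` density from
`i_Q`, with the pointwise bound.

For the divergence, `w_Q` is tested against a smooth horizontal gradient. On almost every path the
fundamental theorem of calculus (`IsHorizontal.integral_inner_gradH`) leaves only the endpoint
values, and integrating over `Q` yields the marginals. The inequality of values follows because the
congestion function is non-decreasing in its second argument. -/

/-- Postcomposition with a function that is Lipschitz on the image preserves absolute continuity. -/
theorem LipschitzOnWith.comp_absolutelyContinuousOnInterval {E F : Type*} [PseudoMetricSpace E]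
    [PseudoMetricSpace F] {K : ℝ≥0} {s : Set E} {g : E → F} {f : ℝ → E} {a b : ℝ}
    (hg : LipschitzOnWith K g s) (hf : AbsolutelyContinuousOnInterval f a b)
    (hs : MapsTo f (uIcc a b) s) : AbsolutelyContinuousOnInterval (g ∘ f) a b := by
  rw [absolutelyContinuousOnInterval_iff] at hf ⊢
  intro ε hε
  -- `K + 1` instead of `K` keeps the denominator positive when `K = 0`.
  obtain ⟨δ, hδ, h⟩ := hf (ε / (K + 1)) (by positivity)
  refine ⟨δ, hδ, fun I hI hlt => ?_⟩
  have hmem := hI.1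
  calc ∑ i ∈ Finset.range I.1, dist ((g ∘ f) (I.2 i).1) ((g ∘ f) (I.2 i).2)
      ≤ ∑ i ∈ Finset.range I.1, (K + 1) * dist (f (I.2 i).1) (f (I.2 i).2) := by
        refine Finset.sum_le_sum fun i hi => ?_
        refine (hg.dist_le_mul _ (hs (hmem i hi).1) _ (hs (hmem i hi).2)).trans ?_
        gcongr
        simp
    _ = (K + 1) * ∑ i ∈ Finset.range I.1, dist (f (I.2 i).1) (f (I.2 i).2) := by
        rw [Finset.mul_sum]
    _ < (K + 1) * (ε / (K + 1)) := by
        gcongr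
        exact h I hI hlt
    _ = ε := by field_simp

/-! ### Calculus along horizontal curves -/

namespace Heis

/-- A horizontal vector is recovered from its frame coordinates, so linearity of the differential
suffices. Horizontality matters: the left side does not see a vertical component. -/
theorem inner_gradH {n : ℕ} (φ : Pt n → ℝ) {x v : Pt n} (hv : v ∈ horFibre x) :
    ⟪gradH φ x, horCoord v⟫_ℝ = fderiv ℝ φ x v := by
  conv_rhs => rw [horFibre_eq_sum hv]
  simp [PiLp.inner_apply, gradH]

/-- The fundamental theorem of calculus along a horizontal curve. -/
theorem IsHorizontal.integral_inner_gradH {n : ℕ} {γ : ℝ → Pt n} (hγ : IsHorizontal γ)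
    {φ : Pt n → ℝ} (hφ : ContDiff ℝ 1 φ) :
    ∫ t in (0 : ℝ)..1, ⟪gradH φ (γ t), horCoord (deriv γ t)⟫_ℝ = φ (γ 1) - φ (γ 0) := by
  -- `φ` is only locally Lipschitz, but the curve stays in a closed ball, which is convex and
  -- compact.
  obtain ⟨C, hC⟩ := hγ.1.exists_bound
  obtain ⟨K, hK⟩ := hφ.contDiffOn.exists_lipschitzOnWith (s := Metric.closedBall 0 C)
    (by simp) (convex_closedBall _ _) (isCompact_closedBall _ _)
  have hac : AbsolutelyContinuousOnInterval (φ ∘ γ) 0 1 :=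
    hK.comp_absolutelyContinuousOnInterval hγ.1 fun t ht => by simpa using hC t ht
  refine Eq.trans (intervalIntegral.integral_congr_ae ?_) hac.integral_deriv_eq_sub
  have h2 := (ae_restrict_iff' measurableSet_Icc).1 hγ.2
  have hd : ∀ᵐ t : ℝ, t ∈ uIcc (0 : ℝ) 1 → DifferentiableAt ℝ γ t :=
    hγ.1.boundedVariationOn.ae_differentiableAt_of_mem_uIcc
  filter_upwards [h2, hd] with t h2 hd ht
  have ht' := uIoc_subset_uIcc ht
  rw [uIcc_of_le zero_le_one] at ht' hd
  rw [inner_gradH φ (h2 ht')]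
  exact (fderiv_comp_deriv t (hφ.differentiable (by simp) _) (hd ht')).symm

/-! ### Disintegration of the velocity over the position -/

section Disintegration

variable {n : ℕ} {Ω : Domain n}

/-- Paths and times with the weight `|σ'(t)|_H`. -/
noncomputable def speedMeasure (Q : Measure (PathSpace Ω)) : Measure (PathSpace Ω × ℝ) :=
  (Q.prod (volume.restrict (Icc (0 : ℝ) 1))).withDensity fun z => ‖z.1.vel z.2‖ₑ

/-- The mean of the direction `σ'(t) / |σ'(t)|_H` over the paths passing through a point. -/
noncomputable def meanDirection (Q : Measure (PathSpace Ω)) [IsFiniteMeasure (speedMeasure Q)]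
    (x : Ω.Closure) : Hor n :=
  ∫ v, ‖v‖⁻¹ • v ∂(ProbabilityTheory.condDistrib (fun z : PathSpace Ω × ℝ => z.1.vel z.2)
    (fun z => z.1.pos z.2) (speedMeasure Q) x)

theorem measurable_direction : Measurable fun v : Hor n => ‖v‖⁻¹ • v :=
  measurable_norm.inv.smul measurable_id

theorem norm_direction_le {E : Type*} [NormedAddCommGroup E] [NormedSpace ℝ E] (v : E) :
    ‖‖v‖⁻¹ • v‖ ≤ 1 := by
  rw [norm_smul, norm_inv, norm_norm]
  exact inv_mul_le_one

theorem trafficIntensity_eq_map (Q : Measure (PathSpace Ω)) :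
    trafficIntensity Q = (speedMeasure Q).map fun z => z.1.pos z.2 := rfl

variable (Q : Measure (PathSpace Ω)) [IsFiniteMeasure (speedMeasure Q)]

/-- An average of vectors of norm at most 1 against a probability measure. This is the source of the
bound of `w_Q` by `i_Q`. -/
theorem norm_meanDirection_le (x : Ω.Closure) : ‖meanDirection Q x‖ ≤ 1 := by
  unfold meanDirection
  refine (norm_integral_le_of_norm_le_const (C := 1)
    (Eventually.of_forall norm_direction_le)).trans ?_
  simp

theorem stronglyMeasurable_meanDirection : StronglyMeasurable (meanDirection Q) :=
  (measurable_direction.stronglyMeasurable.comp_measurable measurable_snd).integral_kernel_prod_right'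

/-- The joint law of position and velocity is `i_Q` composed with the conditional law of the
velocity. Given the position `x`, the value `φ x` is constant and leaves the inner integral. -/
theorem integral_inner_direction (φ : C(Ω.Closure, Hor n)) :
    ∫ z, ⟪φ (z.1.pos z.2), ‖z.1.vel z.2‖⁻¹ • z.1.vel z.2⟫_ℝ ∂speedMeasure Q =
      ∫ x, ⟪φ x, meanDirection Q x⟫_ℝ ∂trafficIntensity Q := by
  have : CompactSpace Ω.Closure := isCompact_iff_compactSpace.1 Ω.isCompact_closure
  have hv : Measurable fun z : PathSpace Ω × ℝ => z.1.vel z.2 := measurable_vel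
  have hp : Measurable fun z : PathSpace Ω × ℝ => z.1.pos z.2 := continuous_pos.measurable
  have hm : Measurable fun y : Ω.Closure × Hor n => ⟪φ y.1, ‖y.2‖⁻¹ • y.2⟫_ℝ :=
    (φ.continuous.measurable.comp measurable_fst).inner (measurable_direction.comp measurable_snd)
  have hb : ∀ y : Ω.Closure × Hor n, ‖⟪φ y.1, ‖y.2‖⁻¹ • y.2⟫_ℝ‖ ≤ ‖φ‖ := fun y =>
    (norm_inner_le_norm _ _).trans <| (mul_le_of_le_one_right (norm_nonneg _)
      (norm_direction_le _)).trans (φ.norm_coe_le_norm _)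
  have h := integral_map (μ := speedMeasure Q) (hp.prodMk hv).aemeasurable
    hm.aestronglyMeasurable
  rw [← h, ← ProbabilityTheory.compProd_map_condDistrib hv.aemeasurable,
    Measure.integral_compProd (.of_bound hm.aestronglyMeasurable _ (Eventually.of_forall hb)),
    ← trafficIntensity_eq_map]
  refine integral_congr_ae (Eventually.of_forall fun x => ?_)
  exact integral_inner (.of_bound measurable_direction.aestronglyMeasurable 1
    (Eventually.of_forall norm_direction_le)) (φ x)

/-- The speed used as weight cancels the normalisation of the direction, so the integral of the
direction against `speedMeasure` is that of the velocity against `Q ⊗ dt`. -/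
theorem vectorTrafficIntensity_eq_integral [SFinite Q] (φ : C(Ω.Closure, Hor n)) :
    vectorTrafficIntensity Q φ = ∫ x, ⟪φ x, meanDirection Q x⟫_ℝ ∂trafficIntensity Q := by
  have : CompactSpace Ω.Closure := isCompact_iff_compactSpace.1 Ω.isCompact_closure
  have hv : Measurable fun z : PathSpace Ω × ℝ => z.1.vel z.2 := measurable_vel
  have hp : Measurable fun z : PathSpace Ω × ℝ => z.1.pos z.2 := continuous_pos.measurable
  -- The integral of the speed is the total mass of `speedMeasure`, which is finite by assumption.
  have hint : Integrable (fun z : PathSpace Ω × ℝ => z.1.vel z.2)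
      (Q.prod (volume.restrict (Icc (0 : ℝ) 1))) := by
    refine ⟨hv.aestronglyMeasurable, ?_⟩
    have := measure_lt_top (speedMeasure Q) univ
    rwa [speedMeasure, withDensity_apply _ MeasurableSet.univ, Measure.restrict_univ] at this
  have hint2 : Integrable (fun z : PathSpace Ω × ℝ => ⟪φ (z.1.pos z.2), z.1.vel z.2⟫_ℝ)
      (Q.prod (volume.restrict (Icc (0 : ℝ) 1))) := by
    refine (hint.norm.const_mul ‖φ‖).mono'
      ((φ.continuous.measurable.comp hp).inner hv).aestronglyMeasurable
      (Eventually.of_forall fun z => (norm_inner_le_norm _ _).trans ?_)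
    gcongr
    exact φ.norm_coe_le_norm _
  have e : speedMeasure Q = (Q.prod (volume.restrict (Icc (0 : ℝ) 1))).withDensity
      fun z => ((‖z.1.vel z.2‖₊ : ℝ≥0) : ℝ≥0∞) := rfl
  rw [← integral_inner_direction, e, integral_withDensity_eq_integral_smul hv.nnnorm,
    vectorTrafficIntensity]
  simp_rw [intervalIntegral.integral_of_le (zero_le_one' ℝ), ← integral_Icc_eq_integral_Ioc]
  rw [← integral_prod _ hint2]
  refine integral_congr_ae (Eventually.of_forall fun z => ?_)
  -- Where the velocity vanishes both integrands are zero, so the convention `0⁻¹ = 0` is harmless.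
  by_cases h0 : z.1.vel z.2 = 0
  · simp [h0]
  · have : ‖z.1.vel z.2‖ ≠ 0 := by simpa using h0
    simp only [inner_smul_right, NNReal.smul_def, coe_nnnorm, smul_eq_mul]
    field_simp

end Disintegration

/-! ### The density of the vector traffic intensity -/

section Density

variable {n : ℕ} {Ω : Domain n}

theorem measurableEmbedding_coe : MeasurableEmbedding (Subtype.val : Ω.Closure → Pt n) :=
  .subtype_coe isClosed_closure.measurableSet

theorem map_lebClosure : Ω.lebClosure.map Subtype.val = Ω.leb := by
  rw [Domain.lebClosure, measurableEmbedding_coe.map_comap, Subtype.range_coe, Domain.leb,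
    Measure.restrict_restrict isClosed_closure.measurableSet,
    inter_eq_right.2 subset_closure]

theorem ae_mem_closure : ∀ᵐ x ∂Ω.leb, x ∈ closure Ω.carrier :=
  (ae_restrict_mem Ω.isOpen.measurableSet).mono fun _ hx => subset_closure hx

/-- The horizontal field representing the vector traffic intensity. -/
noncomputable def trafficField (Q : Measure (PathSpace Ω)) [IsFiniteMeasure (speedMeasure Q)]
    (x : Pt n) : Hor n :=
  intensityDensity Q x • Function.extend Subtype.val (meanDirection Q) 0 x

theorem measurable_intensityDensity (Q : Measure (PathSpace Ω)) :
    Measurable (intensityDensity Q) :=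
  (Measure.measurable_rnDeriv _ _).ennreal_toReal

theorem intensityDensity_nonneg (Q : Measure (PathSpace Ω)) (x : Pt n) :
    0 ≤ intensityDensity Q x := ENNReal.toReal_nonneg

/-- A pushforward preserves total mass, and the density of `i_Q` is integrable because `Ω` has
finite measure, so that `L^p ⊆ L^1`. -/
theorem isFiniteMeasure_speedMeasure {p : ℝ≥0∞} (hp : 1 ≤ p) {μ ν : Measure Ω.Closure}
    {Q : Measure (PathSpace Ω)} (hQ : Q ∈ trafficPlansLp p μ ν) :
    IsFiniteMeasure (speedMeasure Q) := by
  refine ⟨?_⟩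
  have h1 : (trafficIntensity Q).map Subtype.val univ = speedMeasure Q univ := by
    rw [Measure.map_apply measurable_subtype_coe MeasurableSet.univ, trafficIntensity_eq_map,
      Measure.map_apply continuous_pos.measurable (measurable_subtype_coe MeasurableSet.univ)]
    rfl
  rw [← h1, hQ.2.2, withDensity_apply _ MeasurableSet.univ, Measure.restrict_univ]
  exact (hQ.2.1.integrable hp).lintegral_lt_top

variable (Q : Measure (PathSpace Ω)) [IsFiniteMeasure (speedMeasure Q)]

theorem norm_trafficField_le (x : Pt n) : ‖trafficField Q x‖ ≤ intensityDensity Q x := by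
  rw [trafficField, norm_smul, Real.norm_of_nonneg (intensityDensity_nonneg Q x)]
  refine mul_le_of_le_one_right (intensityDensity_nonneg Q x) ?_
  by_cases hx : x ∈ closure Ω.carrier
  · rw [show x = ((⟨x, hx⟩ : Ω.Closure) : Pt n) from rfl, Subtype.val_injective.extend_apply]
    exact norm_meanDirection_le Q _
  · rw [Function.extend_apply']
    · simp
    · rintro ⟨y, rfl⟩
      exact hx y.2

theorem measurable_trafficField : Measurable (trafficField Q) :=
  (measurable_intensityDensity Q).smul
    (measurableEmbedding_coe.measurable_extend (stronglyMeasurable_meanDirection Q).measurable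
      measurable_zero)

variable {Q}

theorem memLp_trafficField {p : ℝ≥0∞} (hd : MemLp (intensityDensity Q) p Ω.leb) :
    MemLp (trafficField Q) p Ω.leb :=
  hd.mono (measurable_trafficField Q).aestronglyMeasurable <| Eventually.of_forall fun x =>
    (norm_trafficField_le Q x).trans (le_abs_self _)

/-- The mean direction is the density of `w_Q` with respect to `i_Q`, and `intensityDensity Q` that
of `i_Q` with respect to Lebesgue measure; their product is `trafficField Q`. -/
theorem vectorTrafficIntensity_eq_densityFunctional [SFinite Q] {p : ℝ≥0∞}
    (hd : MemLp (intensityDensity Q) p Ω.leb)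
    (hi : (trafficIntensity Q).map Subtype.val =
      Ω.leb.withDensity fun x => ENNReal.ofReal (intensityDensity Q x)) :
    vectorTrafficIntensity Q = densityFunctional ((memLp_trafficField hd).toLp) := by
  funext φ
  -- The density of `i_Q` is given on the ambient space, so the integrand is extended by zero off
  -- the closure to change measure there.
  let F : Pt n → ℝ := Function.extend Subtype.val (fun x => ⟪φ x, meanDirection Q x⟫_ℝ) 0
  have hF : ∀ x : Ω.Closure, F x = ⟪φ x, meanDirection Q x⟫_ℝ := fun x =>
    Subtype.val_injective.extend_apply _ _ _
  -- The `L^p` class agrees with `trafficField Q` only a.e. on the ambient space; the inclusion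
  -- preserves measure, so this transfers to the closure.
  have hw : ∀ᵐ x : Ω.Closure ∂Ω.lebClosure,
      (memLp_trafficField hd).toLp (trafficField Q) (x : Pt n) = trafficField Q x := by
    have hm : MeasurePreserving (Subtype.val : Ω.Closure → Pt n) Ω.lebClosure Ω.leb :=
      ⟨measurable_subtype_coe, map_lebClosure⟩
    exact hm.quasiMeasurePreserving.ae (memLp_trafficField hd).coeFn_toLp
  calc vectorTrafficIntensity Q φ
      = ∫ x : Ω.Closure, F x ∂trafficIntensity Q := by
        simp_rw [hF, vectorTrafficIntensity_eq_integral]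
    _ = ∫ x, intensityDensity Q x * F x ∂Ω.leb := by
        rw [← measurableEmbedding_coe.integral_map F, hi,
          integral_withDensity_eq_integral_toReal_smul
            (measurable_intensityDensity Q).ennreal_ofReal (by simp)]
        simp [ENNReal.toReal_ofReal, intensityDensity_nonneg]
    _ = ∫ x : Ω.Closure, intensityDensity Q x * F x ∂Ω.lebClosure := by
        rw [← measurableEmbedding_coe.integral_map (fun x => intensityDensity Q x * F x),
          map_lebClosure]
    _ = densityFunctional ((memLp_trafficField hd).toLp) φ := by
        refine integral_congr_ae (hw.mono fun x hx => ?_)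
        simp only [hx, hF]
        rw [trafficField, Subtype.val_injective.extend_apply, inner_smul_right]

end Density

/-! ### The divergence of the vector traffic intensity -/

theorem densityFunctional_eq_neg_divH {n : ℕ} {Ω : Domain n} {p q : ℝ≥0∞} [Fact (1 ≤ p)]
    [Fact (1 ≤ q)] [ENNReal.HolderConjugate p q] (w : Lp (Hor n) p Ω.leb) {φ : Pt n → ℝ}
    (hφ : ContDiff ℝ ∞ φ) :
    densityFunctional w ⟨fun x => gradH φ x, (continuous_gradH hφ).comp continuous_subtype_val⟩ =
      -divH q w (HW.ofSmooth Ω q φ hφ) := by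
  rw [divH_apply, neg_neg]
  have h := (memLp_of_continuous Ω (continuous_gradH hφ) q).coeFn_toLp
  refine Eq.trans ?_ (integral_congr_ae (f := fun x => ⟪gradH φ x, w x⟫_ℝ) (h.mono fun x hx => ?_))
  · change ∫ x : Ω.Closure, ⟪gradH φ x, w (x : Pt n)⟫_ℝ ∂Ω.lebClosure = _
    rw [← measurableEmbedding_coe.integral_map (fun x => ⟪gradH φ x, w x⟫_ℝ), map_lebClosure]
  · dsimp only
    rw [real_inner_comm, ← hx]
    rfl

/-- The distributional divergence of the vector traffic intensity. -/
theorem vectorTrafficIntensity_gradH {n : ℕ} {Ω : Domain n} {μ ν : Measure Ω.Closure}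
    {Q : Measure (PathSpace Ω)} (hQ : Q ∈ trafficPlans μ ν) {φ : Pt n → ℝ}
    (hφ : ContDiff ℝ ∞ φ) :
    vectorTrafficIntensity Q
        ⟨fun x => gradH φ x, (continuous_gradH hφ).comp continuous_subtype_val⟩ =
      ∫ x : Ω.Closure, φ x ∂ν - ∫ x : Ω.Closure, φ x ∂μ := by
  have : CompactSpace Ω.Closure := isCompact_iff_compactSpace.1 Ω.isCompact_closure
  -- From here on `μ` and `ν` are the images of `Q` under evaluation at 0 and 1.
  obtain ⟨hprob, -, hhor, rfl, rfl⟩ := hQ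
  let ψ : C(Ω.Closure, ℝ) := ⟨fun x => φ x, hφ.continuous.comp continuous_subtype_val⟩
  have he : ∀ t : unitInterval, Continuous fun σ : PathSpace Ω => σ t :=
    fun t => continuous_eval_const t
  have hi : ∀ t : unitInterval, Integrable (fun σ : PathSpace Ω => φ (σ t)) Q := fun t =>
    .of_bound (ψ.continuous.comp (he t)).aestronglyMeasurable ‖ψ‖
      (Eventually.of_forall fun σ => ψ.norm_coe_le_norm (σ t))
  have hψ {m : Measure Ω.Closure} : AEStronglyMeasurable (fun x : Ω.Closure => φ x) m :=
    ψ.continuous.aestronglyMeasurable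
  rw [integral_map (he 1).aemeasurable hψ, integral_map (he 0).aemeasurable hψ,
    ← integral_sub (hi 1) (hi 0)]
  refine integral_congr_ae (hhor.mono fun σ hσ => ?_)
  refine (hσ.integral_inner_gradH (hφ.of_le (by simp))).trans ?_
  simp [PathSpace.curve, PathSpace.pos]

/-! ### Admissibility and comparison of the two values -/

theorem exists_beckmannAdmissible {n : ℕ} {Ω : Domain n} {p q : ℝ≥0∞} [Fact (1 ≤ p)]
    [Fact (1 ≤ q)] [ENNReal.HolderConjugate p q] {μ ν : Measure Ω.Closure}
    {Q : Measure (PathSpace Ω)} (hQ : Q ∈ trafficPlansLp p μ ν) :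
    ∃ w ∈ beckmannAdmissible p q μ ν, vectorTrafficIntensity Q = densityFunctional w ∧
      ∀ᵐ x ∂Ω.leb, ‖w x‖ ≤ intensityDensity Q x := by
  have := isFiniteMeasure_speedMeasure Fact.out hQ
  have := hQ.1.1
  have hw := vectorTrafficIntensity_eq_densityFunctional hQ.2.1 hQ.2.2
  refine ⟨_, fun φ hφ => ?_, hw, ?_⟩
  -- Paths run from `μ` to `ν`, so testing gives `ν - μ`; the minus sign in the divergence turns
  -- this into `μ - ν`.
  · rw [← neg_neg (divH q _ _), ← densityFunctional_eq_neg_divH _ hφ, ← hw,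
      vectorTrafficIntensity_gradH hQ.1 hφ, neg_sub]
  · filter_upwards [(memLp_trafficField hQ.2.1).coeFn_toLp] with x hx
    rw [hx]
    exact norm_trafficField_le Q x

/-- Testing with the constant 1 gives the difference of the total masses, both equal to 1. -/
theorem EqDiff.mem_dualDiamond {n : ℕ} {Ω : Domain n} {q : ℝ≥0∞} [Fact (1 ≤ q)]
    {f : StrongDual ℝ (HW Ω q)} {μ ν : Measure Ω.Closure} [IsProbabilityMeasure μ]
    [IsProbabilityMeasure ν] (hf : EqDiff f μ ν) : f ∈ dualDiamond Ω q := by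
  change f (HW.ofSmooth Ω q (fun _ => 1) contDiff_const) = 0
  rw [hf]
  simp

theorem beckmannValue_le_congestedValue {n : ℕ} {Ω : Domain n} {p q : ℝ≥0∞} [Fact (1 ≤ p)]
    [Fact (1 ≤ q)] [ENNReal.HolderConjugate p q] (μ ν : Measure Ω.Closure) {G : Pt n → ℝ → ℝ}
    (hG : IsCongestionFunction Ω p G) : beckmannValue p q μ ν G ≤ congestedValue p μ ν G := by
  refine le_iInf₂ fun Q hQ => ?_
  obtain ⟨w, hw, -, hle⟩ := exists_beckmannAdmissible (q := q) hQ
  refine (iInf₂_le w hw).trans (lintegral_mono_ae ?_)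
  -- Monotonicity of `G x` is available only for `x` in the closure of the domain.
  filter_upwards [hle, ae_mem_closure] with x hx hxΩ
  exact ENNReal.ofReal_le_ofReal
    (hG.monotone x hxΩ (norm_nonneg _) (intensityDensity_nonneg Q x) hx)

end Heis

theorem proposition5p7 {n : ℕ} (hn : 1 ≤ n) (Ω : Heis.Domain n)
    (p q : ℝ≥0∞) [Fact (1 ≤ p)] [Fact (1 ≤ q)] [ENNReal.HolderConjugate p q]
    (hp : 1 < p) (hp' : p < ⊤)
    (μ ν : Measure Ω.Closure) [IsProbabilityMeasure μ] [IsProbabilityMeasure ν]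
    (hne : (Heis.trafficPlansLp p μ ν).Nonempty) :
    (∃ f ∈ Heis.dualDiamond Ω q, Heis.EqDiff f μ ν) ∧
    (∀ Q ∈ Heis.trafficPlansLp p μ ν, ∃ w ∈ Heis.beckmannAdmissible p q μ ν,
      Heis.vectorTrafficIntensity Q = Heis.densityFunctional w ∧
      ∀ᵐ x ∂Ω.leb, ‖w x‖ ≤ Heis.intensityDensity Q x) ∧
    (∀ G : Heis.Pt n → ℝ → ℝ, Heis.IsCongestionFunction Ω p G →
      Heis.beckmannValue p q μ ν G ≤ Heis.congestedValue p μ ν G) := by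
  refine ⟨?_, fun Q hQ => Heis.exists_beckmannAdmissible hQ,
    fun G hG => Heis.beckmannValue_le_congestedValue μ ν hG⟩
  obtain ⟨Q, hQ⟩ := hne
  obtain ⟨w, hw, -⟩ := Heis.exists_beckmannAdmissible (q := q) hQ
  -- The functional representing `μ - ν` is the divergence of the field of any one plan.
  exact ⟨Heis.divH q w, Heis.EqDiff.mem_dualDiamond hw, hw⟩
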